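/- Let $P$ be a finite partially ordered set. For an integer $k\ge 0$, a *chain $k$-family* in $P$ is a collection $\mathcal C$ of exactly $k$ pairwise disjoint nonempty chains (totally ordered subsets) of $P$; it is *maximal* if $|\bigcup\mathcal C|\ge|\bigcup\mathcal D|$ for every chain $k$-family $\mathcal D$ in $P$. The *comparability graph* $\mathrm{Comp}(P)$ is the undirected graph with vertex set $P$ in which two distinct elements are adjacent if and only if they are comparable. For a chain family $\mathcal C$ let $$\overline{\mathcal C}=\{\{x,y\} : x \text{ covers } y \text{ in some chain } C\in\mathcal C\}$$ (that is, $x,y\in C$, $y<x$, and no $z\in C$ satisfies $y<z<x$), a set of edges of $\mathrm{Comp}(P)$. Here a *path* in $\mathrm{Comp}(P)$ is a walk of positive length that uses no edge more than once; it may pass through a vertex more than once, and its two endpoints may coincide. Write $\mathcal X\triangle\mathcal Y=(\mathcal X\setminus\mathcal Y)\cup(\mathcal Y\setminus\mathcal X)$. 1. Let $k\ge 0$ and let $\mathcal C$ be a maximal chain $k$-family in $P$ with $\bigcup\mathcal C\ne P$. Then there is a maximal chain $(k+1)$-family $\mathcal C'$ such that either $\overline{\mathcal C'}=\overline{\mathcal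 C}\,\triangle\,\mathcal M$, where $\mathcal M$ is the edge set of some path in $\mathrm{Comp}(P)$, or $\mathcal C'=\mathcal C\cup\{\{p\}\}$ for some $p\in P\setminus\bigcup\mathcal C$. 2. Let $k>0$ and let $\mathcal C$ be a maximal chain $k$-family in $P$. Then there is a maximal chain $(k-1)$-family $\mathcal C'$ such that either $\overline{\mathcal C'}=\overline{\mathcal C}\,\triangle\,\mathcal M$, where $\mathcal M$ is the edge set of some path in $\mathrm{Comp}(P)$, or $\mathcal C'=\mathcal C\setminus\{\{p\}\}$ for some one-element chain $\{p\}\in\mathcal C$. -/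

import Mathlib

namespace GreeneKleitman

/-- The comparability graph of a poset: two distinct elements are adjacent when they are
comparable. -/
def comparabilityGraph (P : Type*) [PartialOrder P] : SimpleGraph P where
  Adj x y := x < y ∨ y < x
  symm := ⟨fun _ _ h => h.symm⟩
  loopless := ⟨fun _ h => h.elim (lt_irrefl _) (lt_irrefl _)⟩

/-- A chain `k`-family: a collection of exactly `k` pairwise disjoint nonempty chains.
(`Set.Finite` is automatic in a finite poset; it makes `ncard` an honest count.) -/
structure IsChainFamily {P : Type*} [PartialOrder P] (k : ℕ) (C : Set (Set P)) : Prop where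
  finite : C.Finite
  nonempty : ∀ A ∈ C, A.Nonempty
  isChain : ∀ A ∈ C, IsChain (· ≤ ·) A
  disjoint : ∀ A ∈ C, ∀ B ∈ C, A ≠ B → Disjoint A B
  ncard_eq : C.ncard = k

/-- A maximal chain `k`-family: among all chain `k`-families it covers the largest possible
number of elements. -/
def IsMaximalChainFamily {P : Type*} [PartialOrder P] (k : ℕ) (C : Set (Set P)) : Prop :=
  IsChainFamily k C ∧ ∀ D : Set (Set P), IsChainFamily k D → (⋃₀ D).ncard ≤ (⋃₀ C).ncard

/-- `x` covers `y` in the chain `A`: both lie in `A`, `y < x`, and no element of `A` lies strictly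
between them (elements of the poset outside `A` may). -/
def CoversIn {P : Type*} [PartialOrder P] (A : Set P) (x y : P) : Prop :=
  x ∈ A ∧ y ∈ A ∧ y < x ∧ ∀ z ∈ A, ¬ (y < z ∧ z < x)

/-- The set of edges of the comparability graph associated to a chain family: the pairs `{x, y}`
such that `x` covers `y` in some chain of the family. -/
def chainEdges {P : Type*} [PartialOrder P] (C : Set (Set P)) : Set (Sym2 P) :=
  {e | ∃ A ∈ C, ∃ x y : P, CoversIn A x y ∧ e = s(x, y)}

/-- The edge set of `C'` is the symmetric difference of the edge set of `C` with the edge set of a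
path of positive length in the comparability graph. A path is a walk that uses no edge twice;
it may be closed and may return to a vertex. -/
def DiffersByPath {P : Type*} [PartialOrder P] (C C' : Set (Set P)) : Prop :=
  ∃ (u v : P) (M : (comparabilityGraph P).Walk u v),
    M.IsTrail ∧ 0 < M.length ∧
      chainEdges C' = symmDiff (chainEdges C) {e | e ∈ M.edges}

end GreeneKleitman

/-! Take two copies of `P`, upper and lower, and join an upper `x` to a lower `y` when `y ≤ x`. A
chain family becomes a matching: each point is matched to the one it covers in its chain, and each
point missed by the family to its own copy. The unmatched upper points are the bottoms of the chains
and the loops are the missed points, so a maximal `k`-family is a matching with `k` unmatched upper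
points and fewest loops. Every matching arises this way (`IsMatching.exists_chainFamily`).

Given optimal matchings `M` and `N` with `k` and `k + 1` unmatched upper points, some alternating
path starts at an upper point that only `N` misses and ends with an edge of `M`. Switching both
matchings along it exchanges their sizes and preserves the total number of loops, so both results
are optimal (`switch_optimal`). Identifying the two copies of `P` contracts loops and keeps the
other edges distinct, so the path projects to a trail (`exists_trail`), unless it is a single loop,
which is the one-element chain alternative. -/

namespace GreeneKleitman

open Relation

/-! ### Matchings and alternating paths -/

section Matching

variable {P : Type*}

/-- A matching of the bipartite graph of `≥` on two copies of `P`, as a relation. -/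
structure IsMatching [PartialOrder P] (M : P → P → Prop) : Prop where
  le : ∀ {x y}, M x y → y ≤ x
  right_unique : ∀ {x y z}, M x y → M x z → y = z
  left_unique : ∀ {x y z}, M x z → M y z → x = y

/-- The upper points left unmatched. -/
def bottoms (M : P → P → Prop) : Set P := {x | ∀ y, ¬ M x y}

/-- The points matched with themselves. -/
def loops (M : P → P → Prop) : Set P := {x | M x x}

/-- The edges of the comparability graph underlying a relation. -/
def strictEdges [PartialOrder P] (M : P → P → Prop) : Set (Sym2 P) :=
  {e | ∃ x y, M x y ∧ y < x ∧ e = s(x, y)}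

/-- A matching with `k` unmatched upper points and the least possible number of loops. -/
structure IsOptimalMatching [PartialOrder P] (k : ℕ) (M : P → P → Prop) : Prop extends IsMatching M where
  ncard_bottoms : (bottoms M).ncard = k
  ncard_loops_le : ∀ N : P → P → Prop, IsMatching N → (bottoms N).ncard = k →
    (loops M).ncard ≤ (loops N).ncard

/-- The relation that follows `N` on `S` and `M` outside `S`. -/
def switch (S : Set P) (M N : P → P → Prop) (x y : P) : Prop :=
  (x ∈ S ∧ N x y) ∨ (x ∉ S ∧ M x y)

/-- One alternating step: along `M`, then back along `N`. -/
def alternatingStep (M N : P → P → Prop) (x x' : P) : Prop := ∃ y, M x y ∧ N x' y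

variable {M N : P → P → Prop}

theorem not_step_of_mem_bottoms {a b : P} (hb : b ∈ bottoms N) : ¬ alternatingStep M N a b :=
  fun ⟨_, _, h⟩ => hb _ h

theorem ncard_loops_switch_add [Finite P] (S : Set P) (M N : P → P → Prop) :
    (loops (switch S M N)).ncard + (loops (switch S N M)).ncard =
      (loops M).ncard + (loops N).ncard := by
  have h : ∀ A B : P → P → Prop, (loops (switch S A B)).ncard =
      (loops B ∩ S).ncard + (loops A \ S).ncard := by
    intro A B
    rw [← Set.ncard_union_eq _ (Set.toFinite _) (Set.toFinite _)]
    · congr 1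
      ext x
      simp [loops, switch, and_comm]
    · exact Set.disjoint_left.2 fun x hx hx' => hx'.2 hx.2
  rw [h, h, ← Set.ncard_inter_add_ncard_sdiff_eq_ncard (loops M) S,
    ← Set.ncard_inter_add_ncard_sdiff_eq_ncard (loops N) S]
  ring

variable [PartialOrder P]

theorem comparabilityGraph_adj_of_lt {x y : P} (h : y < x) : (comparabilityGraph P).Adj x y :=
  Or.inr h

/-- The order recovers which end is upper, so distinct non-loop edges of the bipartite graph stay
distinct in the comparability graph. -/
theorem mk_eq_mk_of_lt {x y x' y' : P} (h : y < x) (h' : y' < x')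
    (e : s(x, y) = s(x', y')) : x = x' ∧ y = y' := by
  rcases Sym2.eq_iff.1 e with e | ⟨rfl, rfl⟩
  · exact e
  · exact absurd h h'.asymm

theorem IsMatching.step_right_unique (hM : IsMatching M) (hN : IsMatching N) {a b c : P}
    (h : alternatingStep M N a b) (h' : alternatingStep M N a c) : b = c := by
  obtain ⟨y, h1, h2⟩ := h
  obtain ⟨z, h3, h4⟩ := h'
  obtain rfl := hM.right_unique h1 h3
  exact hN.left_unique h2 h4

theorem IsMatching.step_left_unique (hM : IsMatching M) (hN : IsMatching N) {a b c : P}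
    (h : alternatingStep M N a c) (h' : alternatingStep M N b c) : a = b := by
  obtain ⟨y, h1, h2⟩ := h
  obtain ⟨z, h3, h4⟩ := h'
  obtain rfl := hN.right_unique h2 h4
  exact hM.left_unique h1 h3

/-- Steps are injective and no step enters a point of `bottoms N`, so tracing back from `c` leads to
only one start. -/
theorem eq_of_reach_of_mem_bottoms (hM : IsMatching M) (hN : IsMatching N) {a b c : P}
    (ha : a ∈ bottoms N) (hb : b ∈ bottoms N)
    (hac : ReflTransGen (alternatingStep M N) a c)
    (hbc : ReflTransGen (alternatingStep M N) b c) : a = b := by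
  induction hac generalizing b with
  | refl =>
    rcases ReflTransGen.cases_tail hbc with h | ⟨d, -, h⟩
    · exact h
    · exact absurd h (not_step_of_mem_bottoms ha)
  | tail hd hs ih =>
    rcases ReflTransGen.cases_tail hbc with h | ⟨d, hbd, h⟩
    · exact absurd hs (h ▸ not_step_of_mem_bottoms hb)
    · obtain rfl := hM.step_left_unique hN h hs
      exact ih hb hbd

/-- Injectivity of steps would carry a cycle back along the path to `a`, which no step enters. -/
theorem not_transGen_self (hM : IsMatching M) (hN : IsMatching N) {a c : P}
    (ha : a ∈ bottoms N) (hac : ReflTransGen (alternatingStep M N) a c) :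
    ¬ TransGen (alternatingStep M N) c c := by
  induction hac with
  | refl =>
    intro h
    obtain ⟨d, -, h⟩ := TransGen.tail'_iff.1 h
    exact not_step_of_mem_bottoms ha h
  | tail _ hs ih =>
    intro h
    obtain ⟨d, h1, h2⟩ := TransGen.tail'_iff.1 h
    obtain rfl := hM.step_left_unique hN h2 hs
    exact ih (TransGen.head' hs h1)

/-- If `N` leaves more upper points unmatched than `M`, some alternating path starts at an upper
point unmatched by `N` and never reaches one unmatched by `M`. -/
theorem exists_augmenting_start [Finite P] (hM : IsMatching M) (hN : IsMatching N)
    (hlt : (bottoms M).ncard < (bottoms N).ncard) :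
    ∃ a ∈ bottoms N, ∀ c, ReflTransGen (alternatingStep M N) a c → c ∉ bottoms M := by
  by_contra! h
  choose! f hf hfM using h
  -- Otherwise sending each start to an endpoint in `bottoms M` would be injective, against the
  -- count.
  refine hlt.not_ge (Set.ncard_le_ncard_of_injOn f hfM ?_ (Set.toFinite _))
  intro a ha b hb hab
  exact eq_of_reach_of_mem_bottoms hM hN ha hb (hf a ha) (hab ▸ hf b hb)

/-- Induction on the number of reachable points, peeling off one step. The clause `x ≠ a` serves the
recursive call: its start `b` is matched by `N`, but through the edge just traversed. -/
theorem exists_trail [Finite P] (hM : IsMatching M) (hN : IsMatching N) {a : P}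
    (hacy : ∀ c, ReflTransGen (alternatingStep M N) a c →
      ¬ TransGen (alternatingStep M N) c c)
    (hcov : ∀ c, ReflTransGen (alternatingStep M N) a c → c ∉ bottoms M) :
    ∃ (v : P) (w : (comparabilityGraph P).Walk a v), w.IsTrail ∧
      ∀ e, e ∈ w.edges ↔ ∃ x y, y < x ∧ e = s(x, y) ∧
        ReflTransGen (alternatingStep M N) a x ∧ (M x y ∨ (x ≠ a ∧ N x y)) := by
  induction hn : {c | ReflTransGen (alternatingStep M N) a c}.ncard using Nat.strong_induction_on
    generalizing a with
  | _ n ih =>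
  obtain ⟨y, hy⟩ : ∃ y, M a y := by simpa [bottoms] using hcov a .refl
  by_cases hs : ∃ b, alternatingStep M N a b
  · obtain ⟨b, hab⟩ := hs
    have hby : N b y := by
      obtain ⟨z, h1, h2⟩ := hab
      exact hM.right_unique hy h1 ▸ h2
    have hreach : ∀ x, ReflTransGen (alternatingStep M N) a x ↔
        x = a ∨ ReflTransGen (alternatingStep M N) b x := by
      intro x
      constructor
      · intro h
        rcases ReflTransGen.cases_head h with h | ⟨c, hc, h⟩
        · exact .inl h.symm
        · exact .inr (hM.step_right_unique hN hc hab ▸ h)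
      · rintro (rfl | h)
        · exact .refl
        · exact .head hab h
    have hnb : ¬ ReflTransGen (alternatingStep M N) b a :=
      fun h => hacy a .refl (.head' hab h)
    have hne : b ≠ a := fun h => hnb (h ▸ .refl)
    have hlt : {c | ReflTransGen (alternatingStep M N) b c}.ncard < n := by
      rw [← hn]
      refine Set.ncard_lt_ncard ⟨fun c hc => .head hab hc, fun h => hnb (h ReflTransGen.refl)⟩
        (Set.toFinite _)
    obtain ⟨v, w, hw, hwe⟩ := ih _ hlt (fun c hc => hacy c (.head hab hc))
      (fun c hc => hcov c (.head hab hc)) rfl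
    -- The `N`-edge is traversed upwards; a loop contributes nothing to the walk.
    have key : ∃ w' : (comparabilityGraph P).Walk y v, w'.IsTrail ∧
        ∀ e, e ∈ w'.edges ↔ (y < b ∧ e = s(b, y)) ∨ e ∈ w.edges := by
      rcases (hN.le hby).eq_or_lt with rfl | hlt
      · exact ⟨w, hw, fun e => by simp⟩
      · refine ⟨.cons (comparabilityGraph_adj_of_lt hlt).symm w, ?_, ?_⟩
        · rw [SimpleGraph.Walk.isTrail_cons]
          refine ⟨hw, fun h => ?_⟩
          rw [Sym2.eq_swap, hwe] at h
          obtain ⟨x, z, hzx, he, -, h⟩ := h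
          obtain ⟨rfl, rfl⟩ := mk_eq_mk_of_lt hlt hzx he
          rcases h with h | h
          · exact hne (hM.left_unique h hy)
          · exact h.1 rfl
        · intro e
          simp [hlt, Sym2.eq_swap]
    obtain ⟨w', hw', hwe'⟩ := key
    have key2 : ∃ w'' : (comparabilityGraph P).Walk a v, w''.IsTrail ∧
        ∀ e, e ∈ w''.edges ↔ (y < a ∧ e = s(a, y)) ∨ e ∈ w'.edges := by
      rcases (hM.le hy).eq_or_lt with rfl | hlt
      · exact ⟨w', hw', fun e => by simp⟩
      · refine ⟨.cons (comparabilityGraph_adj_of_lt hlt) w', ?_, ?_⟩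
        · rw [SimpleGraph.Walk.isTrail_cons]
          refine ⟨hw', fun h => ?_⟩
          rw [hwe', hwe] at h
          rcases h with ⟨h1, h2⟩ | ⟨x, z, hzx, he, hx, h⟩
          · exact hne (mk_eq_mk_of_lt hlt h1 h2).1.symm
          · obtain ⟨rfl, rfl⟩ := mk_eq_mk_of_lt hlt hzx he
            exact hnb hx
        · intro e
          simp [hlt]
    obtain ⟨w'', hw'', hwe''⟩ := key2
    refine ⟨v, w'', hw'', fun e => ?_⟩
    rw [hwe'', hwe', hwe]
    constructor
    · rintro (⟨h, rfl⟩ | ⟨h, rfl⟩ | ⟨x, z, hzx, rfl, hx, h⟩)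
      · exact ⟨a, y, h, rfl, .refl, .inl hy⟩
      · exact ⟨b, y, h, rfl, .single hab, .inr ⟨hne, hby⟩⟩
      · exact ⟨x, z, hzx, rfl, .head hab hx, h.imp_right fun h => ⟨fun hxa => hnb (hxa ▸ hx), h.2⟩⟩
    · rintro ⟨x, z, hzx, rfl, hx, h⟩
      rcases (hreach x).1 hx with rfl | hx
      · obtain rfl : y = z := h.elim (hM.right_unique hy) fun h => absurd rfl h.1
        exact .inl ⟨hzx, rfl⟩
      · right
        by_cases hxb : x = b
        · subst hxb
          rcases h with h | h
          · exact .inr ⟨x, z, hzx, rfl, hx, .inl h⟩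
          · obtain rfl := hN.right_unique hby h.2
            exact .inl ⟨hzx, rfl⟩
        · exact .inr ⟨x, z, hzx, rfl, hx, h.imp_right fun h => ⟨hxb, h.2⟩⟩
  · have hreach : ∀ x, ReflTransGen (alternatingStep M N) a x → x = a := by
      intro x h
      rcases ReflTransGen.cases_head h with h | ⟨c, hc, -⟩
      · exact h.symm
      · exact absurd ⟨c, hc⟩ hs
    have hR : ∀ e, (∃ x z, z < x ∧ e = s(x, z) ∧
        ReflTransGen (alternatingStep M N) a x ∧ (M x z ∨ (x ≠ a ∧ N x z))) ↔
        y < a ∧ e = s(a, y) := by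
      intro e
      constructor
      · rintro ⟨x, z, hzx, rfl, hx, h⟩
        obtain rfl := hreach x hx
        obtain rfl : y = z := h.elim (hM.right_unique hy) fun h => absurd rfl h.1
        exact ⟨hzx, rfl⟩
      · rintro ⟨h, rfl⟩
        exact ⟨a, y, h, rfl, .refl, .inl hy⟩
    simp only [hR]
    rcases (hM.le hy).eq_or_lt with rfl | hlt
    · exact ⟨_, .nil, by simp, by simp⟩
    · exact ⟨y, .cons (comparabilityGraph_adj_of_lt hlt) .nil, by simp, by simp [hlt]⟩

/-- An `M`-edge and an `N`-edge with the same lower end form a step, and `hS` puts both upper ends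
on the same side of `S`. -/
theorem IsMatching.switch {S : Set P} (hM : IsMatching M) (hN : IsMatching N)
    (hS : ∀ x x', alternatingStep M N x x' → (x ∈ S ↔ x' ∈ S)) : IsMatching (switch S M N) where
  le := by
    rintro x y (⟨-, h⟩ | ⟨-, h⟩)
    exacts [hN.le h, hM.le h]
  right_unique := by
    rintro x y z (⟨h, h1⟩ | ⟨h, h1⟩) (⟨h', h2⟩ | ⟨h', h2⟩)
    exacts [hN.right_unique h1 h2, absurd h h', absurd h' h, hM.right_unique h1 h2]
  left_unique := by
    rintro x y z (⟨h, h1⟩ | ⟨h, h1⟩) (⟨h', h2⟩ | ⟨h', h2⟩)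
    · exact hN.left_unique h1 h2
    · exact absurd ((hS _ _ ⟨z, h2, h1⟩).2 h) h'
    · exact absurd ((hS _ _ ⟨z, h1, h2⟩).2 h') h
    · exact hM.left_unique h1 h2

/-- Disjointness `hd` is essential: an edge common to both matchings would survive the switch but
vanish from the symmetric difference. -/
theorem strictEdges_switch {S : Set P} {T : Set (Sym2 P)}
    (hT : ∀ e, e ∈ T ↔ ∃ x y, y < x ∧ e = s(x, y) ∧ x ∈ S ∧ (M x y ∨ N x y))
    (hd : ∀ x ∈ S, ∀ y, M x y → ¬ N x y) :
    strictEdges (switch S M N) = symmDiff (strictEdges M) T := by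
  have hmem : ∀ (A : P → P → Prop) {x y : P}, y < x → (s(x, y) ∈ strictEdges A ↔ A x y) := by
    intro A x y h
    constructor
    · rintro ⟨x', y', hA, h', e⟩
      obtain ⟨rfl, rfl⟩ := mk_eq_mk_of_lt h h' e
      exact hA
    · exact fun hA => ⟨x, y, hA, h, rfl⟩
  have hmemT : ∀ {x y : P}, y < x → (s(x, y) ∈ T ↔ x ∈ S ∧ (M x y ∨ N x y)) := by
    intro x y h
    rw [hT]
    constructor
    · rintro ⟨x', y', h', e, hA⟩
      obtain ⟨rfl, rfl⟩ := mk_eq_mk_of_lt h h' e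
      exact hA
    · exact fun hA => ⟨x, y, h, rfl, hA⟩
  ext e
  by_cases he : ∃ x y, y < x ∧ e = s(x, y)
  · obtain ⟨x, y, h, rfl⟩ := he
    rw [Set.mem_symmDiff, hmem _ h, hmem _ h, hmemT h]
    have := hd x
    unfold switch
    have := hd x
    grind
  · have h1 : ∀ A : P → P → Prop, e ∉ strictEdges A := by
      rintro A ⟨x, y, -, h, rfl⟩
      exact he ⟨x, y, h, rfl⟩
    have h2 : e ∉ T := by
      rw [hT]
      rintro ⟨x, y, h, h', -⟩
      exact he ⟨x, y, h, h'⟩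
    simp [Set.mem_symmDiff, h1, h2]

/-- The sizes trade places because only `a` changes status. Neither new loop count is below its
minimum and their sum is the sum of the minima, so both are minimal. -/
theorem switch_optimal [Finite P] {k : ℕ} (hM : IsOptimalMatching k M)
    (hN : IsOptimalMatching (k + 1) N) {S : Set P} {a : P}
    (hS : ∀ x x', alternatingStep M N x x' → (x ∈ S ↔ x' ∈ S))
    (hSM : S ∩ bottoms M = ∅) (hSN : S ∩ bottoms N = {a}) :
    IsOptimalMatching (k + 1) (switch S M N) ∧ IsOptimalMatching k (switch S N M) := by
  have hM' := hM.toIsMatching.switch hN.toIsMatching hS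
  have hN' := hN.toIsMatching.switch hM.toIsMatching
    (fun x x' ⟨y, h1, h2⟩ => (hS x' x ⟨y, h2, h1⟩).symm)
  have hSM' : ∀ x ∈ S, x ∉ bottoms M := fun x hx hb => by
    have : x ∈ S ∩ bottoms M := ⟨hx, hb⟩
    simp [hSM] at this
  have hSN' : ∀ x, x ∈ S → (x ∈ bottoms N ↔ x = a) := fun x hx => by
    have : x ∈ S ∩ bottoms N ↔ x = a := by simp [hSN]
    simpa [hx] using this
  have ha : a ∈ S ∩ bottoms N := by simp [hSN]
  have hb : ∀ (A B : P → P → Prop) (x : P), x ∈ bottoms (switch S A B) ↔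
      (x ∈ S ∧ x ∈ bottoms B) ∨ (x ∉ S ∧ x ∈ bottoms A) := by
    intro A B x
    by_cases hx : x ∈ S <;> simp [bottoms, switch, hx]
  have b1 : (bottoms (switch S M N)).ncard = k + 1 := by
    have : bottoms (switch S M N) = insert a (bottoms M) := by
      ext x
      rw [hb, Set.mem_insert_iff]
      have := hSM' x
      have := hSN' x
      grind
    rw [this, Set.ncard_insert_of_notMem (hSM' a ha.1) (Set.toFinite _), hM.ncard_bottoms]
  have b2 : (bottoms (switch S N M)).ncard = k := by
    have : bottoms (switch S N M) = bottoms N \ {a} := by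
      ext x
      rw [hb, Set.mem_sdiff, Set.mem_singleton_iff]
      have := hSM' x
      have := hSN' x
      grind
    rw [this, Set.ncard_sdiff_singleton_of_mem ha.2, hN.ncard_bottoms, Nat.add_sub_cancel]
  have hsum := ncard_loops_switch_add S M N
  have h1 := hM.ncard_loops_le _ hN' b2
  have h2 := hN.ncard_loops_le _ hM' b1
  refine ⟨⟨hM', b1, fun L hL hk => ?_⟩, ⟨hN', b2, fun L hL hk => ?_⟩⟩
  · have := hN.ncard_loops_le L hL hk
    omega
  · have := hM.ncard_loops_le L hL hk
    omega

/-- Two optimal matchings of consecutive sizes can be exchanged along an alternating path, which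
projects to a trail of the comparability graph or is a single loop. -/
theorem exists_optimal_exchange [Finite P] {k : ℕ} (hM : IsOptimalMatching k M)
    (hN : IsOptimalMatching (k + 1) N) :
    ∃ M' N' : P → P → Prop, IsOptimalMatching (k + 1) M' ∧ IsOptimalMatching k N' ∧
      ((∃ (u v : P) (w : (comparabilityGraph P).Walk u v), w.IsTrail ∧ 0 < w.length ∧
          strictEdges M' = symmDiff (strictEdges M) {e | e ∈ w.edges} ∧
          strictEdges N' = symmDiff (strictEdges N) {e | e ∈ w.edges}) ∨
        ∃ p, p ∈ loops M ∧ p ∈ bottoms N ∧ (∀ x, ¬ N x p) ∧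
          loops M' = loops M \ {p} ∧ loops N' = insert p (loops N)) := by
  have hM0 := hM.toIsMatching
  have hN0 := hN.toIsMatching
  obtain ⟨a, ha, hcov⟩ := exists_augmenting_start hM0 hN0
    (by rw [hM.ncard_bottoms, hN.ncard_bottoms]; omega)
  -- The upper points of the augmenting path.
  set S : Set P := {c | ReflTransGen (alternatingStep M N) a c} with hSdef
  have hS : ∀ x x', alternatingStep M N x x' → (x ∈ S ↔ x' ∈ S) := by
    intro x x' h
    constructor
    · exact fun hx => ReflTransGen.tail hx h
    · intro hx'
      rcases ReflTransGen.cases_tail hx' with rfl | ⟨d, hd, h'⟩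
      · exact absurd h (not_step_of_mem_bottoms ha)
      · exact hM0.step_left_unique hN0 h h' ▸ hd
  have hSN : S ∩ bottoms N = {a} := by
    ext x
    constructor
    · rintro ⟨hx, hb⟩
      exact (eq_of_reach_of_mem_bottoms hM0 hN0 ha hb hx .refl).symm
    · rintro rfl
      exact ⟨ReflTransGen.refl, ha⟩
  have hSM : S ∩ bottoms M = ∅ :=
    Set.eq_empty_of_forall_notMem fun x hx => hcov x hx.1 hx.2
  obtain ⟨h1, h2⟩ := switch_optimal hM hN hS hSM hSN
  have hacy : ∀ c, ReflTransGen (alternatingStep M N) a c →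
      ¬ TransGen (alternatingStep M N) c c := fun c hc => not_transGen_self hM0 hN0 ha hc
  refine ⟨_, _, h1, h2, ?_⟩
  obtain ⟨v, w, hw, hwe⟩ := exists_trail hM0 hN0 hacy hcov
  have hwe' : ∀ e, e ∈ {e | e ∈ w.edges} ↔
      ∃ x y, y < x ∧ e = s(x, y) ∧ x ∈ S ∧ (M x y ∨ N x y) := by
    intro e
    rw [Set.mem_ofPred_eq, hwe]
    refine exists_congr fun x => exists_congr fun y => and_congr_right fun _ =>
      and_congr_right fun _ => and_congr_right fun _ => or_congr_right ?_
    exact ⟨fun h => h.2, fun h => ⟨fun hx => ha y (hx ▸ h), h⟩⟩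
  have hd : ∀ x ∈ S, ∀ y, M x y → ¬ N x y := fun x hx y h h' =>
    -- A common edge would be a step from `x` to itself.
    hacy x hx (.single ⟨y, h, h'⟩)
  by_cases hlen : 0 < w.length
  · refine .inl ⟨a, v, w, hw, hlen, strictEdges_switch hwe' hd, strictEdges_switch ?_ ?_⟩
    · simpa only [or_comm] using hwe'
    · exact fun x hx y h h' => hd x hx y h' h
  · right
    have hnil : w.edges = [] := by
      rw [← List.length_eq_zero_iff, SimpleGraph.Walk.length_edges]
      omega
    -- All edges at `S` are now loops. The path starts with the `M`-loop at `a`, and an `N`-edge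
    -- continuing it would be a loop at `a`, which `N` leaves unmatched; so the path stops there.
    have hnone : ∀ x ∈ S, ∀ y, y < x → ¬ (M x y ∨ N x y) := by
      intro x hx y h hxy
      have := (hwe' s(x, y)).2 ⟨x, y, h, rfl, hx, hxy⟩
      simp [hnil] at this
    have haS : a ∈ S := ReflTransGen.refl
    have hMa : M a a := by
      obtain ⟨y, hy⟩ : ∃ y, M a y := by simpa [bottoms] using hcov a .refl
      rcases (hM0.le hy).eq_or_lt with rfl | h
      · exact hy
      · exact absurd (.inl hy) (hnone a haS y h)
    have hNa : ∀ x, ¬ N x a := by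
      intro x hx
      have hxS : x ∈ S := (hS a x ⟨a, hMa, hx⟩).1 haS
      rcases (hN0.le hx).eq_or_lt with rfl | h
      · exact ha _ hx
      · exact hnone x hxS a h (.inr hx)
    have hSa : S = {a} := by
      ext x
      constructor
      · intro hx
        rcases ReflTransGen.cases_head hx with h | ⟨c, ⟨y, hy, hc⟩, -⟩
        · exact h.symm
        · exact absurd (hM0.right_unique hMa hy ▸ hc) (hNa c)
      · rintro rfl
        exact haS
    refine ⟨a, hMa, ha, hNa, ?_, ?_⟩
    · ext x
      simp only [loops, switch, hSa, Set.mem_ofPred_eq, Set.mem_sdiff, Set.mem_singleton_iff]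
      have := hNa a
      grind
    · ext x
      simp only [loops, switch, hSa, Set.mem_ofPred_eq, Set.mem_insert_iff, Set.mem_singleton_iff]
      grind

end Matching

/-! ### Chain families as matchings -/

section ChainFamily

variable {P : Type*} [PartialOrder P]

/-- The matching of a chain family: covers in its chains, and loops at the points it misses. -/
def chainMatching (C : Set (Set P)) (x y : P) : Prop :=
  (∃ A ∈ C, CoversIn A x y) ∨ (x = y ∧ x ∉ ⋃₀ C)

theorem exists_coversIn_left [Finite P] {A : Set P} {x z : P}
    (hx : x ∈ A) (hz : z ∈ A) (h : z < x) : ∃ y, CoversIn A x y := by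
  obtain ⟨y, hy⟩ := (Set.toFinite {y | y ∈ A ∧ y < x}).exists_maximal ⟨z, hz, h⟩
  exact ⟨y, hx, hy.prop.1, hy.prop.2, fun w hw hyw => hyw.1.not_ge (hy.2 ⟨hw, hyw.2⟩ hyw.1.le)⟩

theorem exists_coversIn_right [Finite P] {A : Set P} {x z : P}
    (hx : x ∈ A) (hz : z ∈ A) (h : x < z) : ∃ y, CoversIn A y x := by
  obtain ⟨y, hy⟩ := (Set.toFinite {y | y ∈ A ∧ x < y}).exists_minimal ⟨z, hz, h⟩
  exact ⟨y, hy.prop.1, hx, hy.prop.2, fun w hw hyw => hyw.2.not_ge (hy.2 ⟨hw, hyw.1⟩ hyw.2.le)⟩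

theorem exists_least_of_isChain [Finite P] {A : Set P} (hA : IsChain (· ≤ ·) A)
    (hne : A.Nonempty) : ∃ m ∈ A, ∀ x ∈ A, m ≤ x := by
  obtain ⟨m, hm⟩ := (Set.toFinite A).exists_minimal hne
  exact ⟨m, hm.prop, fun x hx => (hA.total hm.prop hx).elim id fun h => hm.2 hx h⟩

variable {k : ℕ} {C : Set (Set P)}

theorem IsChainFamily.eq_of_mem (hC : IsChainFamily k C) {A B : Set P} {x : P} (hA : A ∈ C)
    (hB : B ∈ C) (hxA : x ∈ A) (hxB : x ∈ B) : A = B := by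
  by_contra h
  exact Set.disjoint_left.1 (hC.disjoint A hA B hB h) hxA hxB

theorem IsChainFamily.isMatching (hC : IsChainFamily k C) : IsMatching (chainMatching C) where
  le := by
    rintro x y (⟨A, -, -, -, h, -⟩ | ⟨rfl, -⟩)
    exacts [h.le, le_rfl]
  right_unique := by
    rintro x y z (⟨A, hA, h⟩ | ⟨rfl, h⟩) (⟨B, hB, h'⟩ | ⟨rfl, h'⟩)
    · obtain rfl := hC.eq_of_mem hA hB h.1 h'.1
      by_contra hne
      rcases (hC.isChain A hA).total h.2.1 h'.2.1 with hl | hl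
      · exact h.2.2.2 z h'.2.1 ⟨lt_of_le_of_ne hl hne, h'.2.2.1⟩
      · exact h'.2.2.2 y h.2.1 ⟨lt_of_le_of_ne hl (Ne.symm hne), h.2.2.1⟩
    · exact absurd ⟨A, hA, h.1⟩ h'
    · exact absurd ⟨B, hB, h'.1⟩ h
    · rfl
  left_unique := by
    rintro x y z (⟨A, hA, h⟩ | ⟨rfl, h⟩) (⟨B, hB, h'⟩ | ⟨rfl, h'⟩)
    · obtain rfl := hC.eq_of_mem hA hB h.2.1 h'.2.1
      by_contra hne
      rcases (hC.isChain A hA).total h.1 h'.1 with hl | hl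
      · exact h'.2.2.2 x h.1 ⟨h.2.2.1, lt_of_le_of_ne hl hne⟩
      · exact h.2.2.2 y h'.1 ⟨h'.2.2.1, lt_of_le_of_ne hl (Ne.symm hne)⟩
    · exact absurd ⟨A, hA, h.2.1⟩ h'
    · exact absurd ⟨B, hB, h'.2.1⟩ h
    · rfl

/-- The unmatched upper points are exactly the least elements of the chains, one for each. -/
theorem IsChainFamily.ncard_bottoms [Finite P] (hC : IsChainFamily k C) :
    (bottoms (chainMatching C)).ncard = k := by
  have hex : ∀ A ∈ C, ∃ m ∈ A, ∀ x ∈ A, m ≤ x := fun A hA =>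
    exists_least_of_isChain (hC.isChain A hA) (hC.nonempty A hA)
  choose m hm hle using hex
  rw [← hC.ncard_eq]
  refine (Set.ncard_congr m ?_ ?_ ?_).symm
  · rintro A hA y (⟨B, hB, h⟩ | ⟨-, h⟩)
    · obtain rfl := hC.eq_of_mem hA hB (hm A hA) h.1
      exact h.2.2.1.not_ge (hle A hA y h.2.1)
    · exact h ⟨A, hA, hm A hA⟩
  · exact fun A B hA hB h => hC.eq_of_mem hA hB (hm A hA) (h ▸ hm B hB)
  · intro x hx
    obtain ⟨A, hA, hxA⟩ : x ∈ ⋃₀ C := by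
      by_contra h
      exact hx x (.inr ⟨rfl, h⟩)
    refine ⟨A, hA, ?_⟩
    by_contra hne
    obtain ⟨y, hy⟩ := exists_coversIn_left hxA (hm A hA) (lt_of_le_of_ne (hle A hA x hxA) hne)
    exact hx y (.inl ⟨A, hA, hy⟩)

theorem loops_chainMatching (C : Set (Set P)) : loops (chainMatching C) = (⋃₀ C)ᶜ := by
  ext x
  simp only [loops, chainMatching, Set.mem_ofPred_eq, Set.mem_compl_iff, true_and]
  exact or_iff_right fun ⟨A, _, h⟩ => lt_irrefl _ h.2.2.1

theorem strictEdges_chainMatching (C : Set (Set P)) :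
    strictEdges (chainMatching C) = chainEdges C := by
  ext e
  constructor
  · rintro ⟨x, y, ⟨A, hA, h⟩ | ⟨rfl, -⟩, hlt, rfl⟩
    · exact ⟨A, hA, x, y, h, rfl⟩
    · exact absurd hlt (lt_irrefl _)
  · rintro ⟨A, hA, x, y, h, rfl⟩
    exact ⟨x, y, .inl ⟨A, hA, h⟩, h.2.2.1, rfl⟩

/-! ### Chain families recovered from matchings -/

/-- The non-loop part of a relation. -/
def strictPart (M : P → P → Prop) (x y : P) : Prop := M x y ∧ y < x

/-- The points from which the non-loop part of `M` descends to `b`. -/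
def chainAbove (M : P → P → Prop) (b : P) : Set P := {x | ReflTransGen (strictPart M) x b}

variable {M : P → P → Prop}

theorem le_of_reflTransGen_strictPart {x y : P} (h : ReflTransGen (strictPart M) x y) :
    y ≤ x := by
  induction h with
  | refl => exact le_rfl
  | tail _ h ih => exact h.2.le.trans ih

/-- Left uniqueness makes the ascent from `b` deterministic. -/
theorem IsMatching.total_of_mem_chainAbove (hM : IsMatching M) {b x y : P}
    (hx : x ∈ chainAbove M b) (hy : y ∈ chainAbove M b) :
    ReflTransGen (strictPart M) x y ∨ ReflTransGen (strictPart M) y x := by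
  induction hx with
  | refl => exact .inr hy
  | @tail c d hxc hcd ih =>
    rcases ReflTransGen.cases_tail hy with rfl | ⟨e, hye, hed⟩
    · exact .inl (hxc.tail hcd)
    · obtain rfl := hM.left_unique hed.1 hcd.1
      exact ih hye

theorem eq_of_reflTransGen_bottom {b y : P} (hb : b ∈ bottoms M)
    (h : ReflTransGen (strictPart M) b y) : y = b := by
  rcases ReflTransGen.cases_head h with h | ⟨c, hc, -⟩
  · exact h.symm
  · exact absurd hc.1 (hb c)

theorem IsMatching.bottom_unique (hM : IsMatching M) {x b c : P} (hb : b ∈ bottoms M)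
    (hc : c ∈ bottoms M) (hxb : x ∈ chainAbove M b) (hxc : x ∈ chainAbove M c) : b = c := by
  have hr : Relator.RightUnique (strictPart M) := fun _ _ _ h h' => hM.right_unique h.1 h'.1
  rcases ReflTransGen.total_of_right_unique hr hxb hxc with h | h
  · exact (eq_of_reflTransGen_bottom hb h).symm
  · exact eq_of_reflTransGen_bottom hc h

theorem IsMatching.notMem_loops_of_mem_chainAbove (hM : IsMatching M) {b x : P}
    (hb : b ∈ bottoms M) (hx : x ∈ chainAbove M b) : x ∉ loops M := by
  intro hl
  rcases ReflTransGen.cases_head hx with rfl | ⟨c, hc, -⟩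
  · exact hb _ hl
  · exact hc.2.ne (hM.right_unique hc.1 hl)

theorem IsMatching.exists_mem_chainAbove [Finite P] (hM : IsMatching M) {x : P}
    (hx : x ∉ loops M) : ∃ b ∈ bottoms M, x ∈ chainAbove M b := by
  induction x using (Finite.wellFounded_of_trans_of_irrefl (α := P) (· < ·)).induction with
  | _ x ih =>
  by_cases hb : x ∈ bottoms M
  · exact ⟨x, hb, ReflTransGen.refl⟩
  · obtain ⟨y, hy⟩ : ∃ y, M x y := by simpa [bottoms] using hb
    have hlt : y < x := lt_of_le_of_ne (hM.le hy) (fun h => hx (h ▸ hy : M x x))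
    obtain ⟨b, hb, hyb⟩ := ih y hlt fun hl => hlt.ne' (hM.left_unique hy hl)
    exact ⟨b, hb, ReflTransGen.head ⟨hy, hlt⟩ hyb⟩

theorem IsMatching.coversIn_chainAbove (hM : IsMatching M) {b x y : P} :
    CoversIn (chainAbove M b) x y ↔ strictPart M x y ∧ y ∈ chainAbove M b := by
  constructor
  · rintro ⟨hx, hy, hlt, hno⟩
    refine ⟨?_, hy⟩
    rcases hM.total_of_mem_chainAbove hx hy with h | h
    · rcases ReflTransGen.cases_head h with rfl | ⟨c, hc, hcy⟩
      · exact absurd hlt (lt_irrefl _)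
      · rcases (le_of_reflTransGen_strictPart hcy).eq_or_lt with rfl | hyc
        · exact hc
        · refine absurd ⟨hyc, hc.2⟩ (hno c (hcy.trans hy))
    · exact absurd (le_of_reflTransGen_strictPart h) hlt.not_ge
  · rintro ⟨h, hy⟩
    have hx : x ∈ chainAbove M b := ReflTransGen.head h hy
    refine ⟨hx, hy, h.2, fun z hz ⟨hyz, hzx⟩ => ?_⟩
    rcases hM.total_of_mem_chainAbove hx hz with h' | h'
    · rcases ReflTransGen.cases_head h' with rfl | ⟨c, hc, hcz⟩
      · exact lt_irrefl _ hzx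
      · obtain rfl := hM.right_unique h.1 hc.1
        exact hyz.not_ge (le_of_reflTransGen_strictPart hcz)
    · exact hzx.not_ge (le_of_reflTransGen_strictPart h')

/-- Every matching comes from a chain family. -/
theorem IsMatching.exists_chainFamily [Finite P] (hM : IsMatching M) :
    ∃ C : Set (Set P), IsChainFamily (bottoms M).ncard C ∧ (⋃₀ C)ᶜ = loops M ∧
      chainEdges C = strictEdges M := by
  refine ⟨chainAbove M '' bottoms M, ⟨Set.toFinite _, ?_, ?_, ?_, ?_⟩, ?_, ?_⟩
  · rintro _ ⟨b, -, rfl⟩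
    exact ⟨b, ReflTransGen.refl⟩
  · rintro _ ⟨b, -, rfl⟩ x hx y hy -
    exact (hM.total_of_mem_chainAbove hx hy).symm.imp le_of_reflTransGen_strictPart
      le_of_reflTransGen_strictPart
  · rintro _ ⟨b, hb, rfl⟩ _ ⟨c, hc, rfl⟩ hne
    refine Set.disjoint_left.2 fun x hx hx' => hne ?_
    rw [hM.bottom_unique hb hc hx hx']
  · refine Set.InjOn.ncard_image fun b hb c hc h => ?_
    have hmem : b ∈ chainAbove M b := ReflTransGen.refl
    exact hM.bottom_unique hb hc hmem (h ▸ hmem)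
  · ext x
    constructor
    · intro hx
      by_contra hl
      obtain ⟨b, hb, hxb⟩ := hM.exists_mem_chainAbove hl
      exact hx ⟨_, ⟨b, hb, rfl⟩, hxb⟩
    · rintro hl ⟨_, ⟨b, hb, rfl⟩, hxb⟩
      exact hM.notMem_loops_of_mem_chainAbove hb hxb hl
  · ext e
    constructor
    · rintro ⟨_, ⟨b, -, rfl⟩, x, y, h, rfl⟩
      have h' := (hM.coversIn_chainAbove.1 h).1
      exact ⟨x, y, h'.1, h'.2, rfl⟩
    · rintro ⟨x, y, h, hlt, rfl⟩
      obtain ⟨b, hb, hyb⟩ := hM.exists_mem_chainAbove (x := y)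
        fun hl => hlt.ne' (hM.left_unique h hl)
      exact ⟨_, ⟨b, hb, rfl⟩, x, y, hM.coversIn_chainAbove.2 ⟨⟨h, hlt⟩, hyb⟩, rfl⟩

/-! ### Maximality, optimality and the two exchange statements -/

theorem IsMaximalChainFamily.isOptimalMatching [Finite P] (hC : IsMaximalChainFamily k C) :
    IsOptimalMatching k (chainMatching C) where
  toIsMatching := hC.1.isMatching
  ncard_bottoms := hC.1.ncard_bottoms
  ncard_loops_le := by
    rintro N hN rfl
    obtain ⟨D, hD, hl, -⟩ := hN.exists_chainFamily
    rw [loops_chainMatching, ← hl]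
    have h1 := hC.2 D hD
    have h2 := Set.ncard_add_ncard_compl (⋃₀ C)
    have h3 := Set.ncard_add_ncard_compl (⋃₀ D)
    omega

/-- Only the loop count ties `C` to `M`, so the bound applies to families built directly by adding
or deleting a singleton. -/
theorem IsOptimalMatching.ncard_sUnion_le [Finite P] (hM : IsOptimalMatching k M)
    (hC : (loops M).ncard = (⋃₀ C)ᶜ.ncard) {D : Set (Set P)} (hD : IsChainFamily k D) :
    (⋃₀ D).ncard ≤ (⋃₀ C).ncard := by
  have h1 := hM.ncard_loops_le _ hD.isMatching hD.ncard_bottoms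
  rw [loops_chainMatching] at h1
  have h2 := Set.ncard_add_ncard_compl (⋃₀ C)
  have h3 := Set.ncard_add_ncard_compl (⋃₀ D)
  omega

theorem IsOptimalMatching.exists_maximalChainFamily [Finite P] (hM : IsOptimalMatching k M) :
    ∃ C : Set (Set P), IsMaximalChainFamily k C ∧ chainEdges C = strictEdges M := by
  obtain ⟨C, hC, hl, he⟩ := hM.toIsMatching.exists_chainFamily
  rw [hM.ncard_bottoms] at hC
  exact ⟨C, ⟨hC, fun D hD => hM.ncard_sUnion_le (by rw [hl]) hD⟩, he⟩

theorem IsChainFamily.exists_maximal [Finite P] (hC : IsChainFamily k C) :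
    ∃ D : Set (Set P), IsMaximalChainFamily k D := by
  obtain ⟨D, hD, hmax⟩ := Set.exists_max_image {D : Set (Set P) | IsChainFamily k D}
    (fun D => (⋃₀ D).ncard) (Set.toFinite _) ⟨C, hC⟩
  exact ⟨D, hD, hmax⟩

theorem IsChainFamily.insert_singleton [Finite P] (hC : IsChainFamily k C) {p : P}
    (hp : p ∉ ⋃₀ C) : IsChainFamily (k + 1) (insert {p} C) where
  finite := Set.toFinite _
  nonempty := by
    rintro A (rfl | hA)
    exacts [Set.singleton_nonempty p, hC.nonempty A hA]
  isChain := by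
    rintro A (rfl | hA)
    exacts [Set.pairwise_singleton _ _, hC.isChain A hA]
  disjoint := by
    have h : ∀ A ∈ C, Disjoint {p} A := fun A hA =>
      Set.disjoint_singleton_left.2 fun hpA => hp ⟨A, hA, hpA⟩
    rintro A (rfl | hA) B (rfl | hB) hne
    exacts [absurd rfl hne, h B hB, (h A hA).symm, hC.disjoint A hA B hB hne]
  ncard_eq := by
    rw [Set.ncard_insert_of_notMem (fun h => hp ⟨{p}, h, rfl⟩) (Set.toFinite _), hC.ncard_eq]

theorem IsChainFamily.diff_singleton [Finite P] (hC : IsChainFamily (k + 1) C) {A : Set P}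
    (hA : A ∈ C) : IsChainFamily k (C \ {A}) where
  finite := Set.toFinite _
  nonempty B hB := hC.nonempty B hB.1
  isChain B hB := hC.isChain B hB.1
  disjoint B hB D hD := hC.disjoint B hB.1 D hD.1
  ncard_eq := by
    rw [Set.ncard_sdiff_singleton_of_mem hA, hC.ncard_eq, Nat.add_sub_cancel]

theorem IsMaximalChainFamily.exists_succ [Finite P] (hC : IsMaximalChainFamily k C)
    (hne : ⋃₀ C ≠ Set.univ) : ∃ C' : Set (Set P), IsMaximalChainFamily (k + 1) C' ∧
      (DiffersByPath C C' ∨ ∃ p : P, p ∉ ⋃₀ C ∧ C' = insert {p} C) := by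
  obtain ⟨q, hq⟩ := (Set.ne_univ_iff_exists_notMem _).1 hne
  -- The uncovered point guarantees that some `(k + 1)`-family exists, hence a maximal one to
  -- compare with.
  obtain ⟨D, hD⟩ := (hC.1.insert_singleton hq).exists_maximal
  obtain ⟨M, _, hM, -, h⟩ :=
    exists_optimal_exchange hC.isOptimalMatching hD.isOptimalMatching
  rcases h with ⟨u, v, w, hw, hlen, he, -⟩ | ⟨p, hp, -, -, hl, -⟩
  · obtain ⟨C', hC', he'⟩ := hM.exists_maximalChainFamily
    refine ⟨C', hC', .inl ⟨u, v, w, hw, hlen, ?_⟩⟩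
    rw [he', he, strictEdges_chainMatching]
  · rw [loops_chainMatching] at hp hl
    refine ⟨_, ⟨hC.1.insert_singleton hp, fun E hE => hM.ncard_sUnion_le ?_ hE⟩,
      .inr ⟨p, hp, rfl⟩⟩
    congr 1
    rw [hl]
    ext x
    simp [and_comm]

theorem IsMaximalChainFamily.exists_pred [Finite P] (hC : IsMaximalChainFamily (k + 1) C) :
    ∃ C' : Set (Set P), IsMaximalChainFamily k C' ∧
      (DiffersByPath C C' ∨ ∃ p : P, {p} ∈ C ∧ C' = C \ {{p}}) := by
  obtain ⟨A, hA⟩ : C.Nonempty := Set.nonempty_of_ncard_ne_zero (by rw [hC.1.ncard_eq]; omega)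
  obtain ⟨D, hD⟩ := (hC.1.diff_singleton hA).exists_maximal
  -- Here `C` is the larger family, so the second matching of the exchange is the one kept.
  obtain ⟨_, M, -, hM, h⟩ :=
    exists_optimal_exchange hD.isOptimalMatching hC.isOptimalMatching
  rcases h with ⟨u, v, w, hw, hlen, -, he⟩ | ⟨p, -, hb, ht, -, hl⟩
  · obtain ⟨C', hC', he'⟩ := hM.exists_maximalChainFamily
    refine ⟨C', hC', .inl ⟨u, v, w, hw, hlen, ?_⟩⟩
    rw [he', he, strictEdges_chainMatching]
  · rw [loops_chainMatching] at hl
    obtain ⟨B, hB, hpB⟩ : p ∈ ⋃₀ C := by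
      by_contra h
      exact hb p (.inr ⟨rfl, h⟩)
    -- Neither copy of `p` is matched, so `p` covers nothing and is covered by nothing in its chain.
    have hBp : B = {p} := by
      refine Set.eq_singleton_iff_unique_mem.2 ⟨hpB, fun q hq => ?_⟩
      by_contra hne
      rcases (hC.1.isChain B hB).total hpB hq with h | h
      · obtain ⟨y, hy⟩ := exists_coversIn_right hpB hq (lt_of_le_of_ne h (Ne.symm hne))
        exact ht y (.inl ⟨B, hB, hy⟩)
      · obtain ⟨y, hy⟩ := exists_coversIn_left hpB hq (lt_of_le_of_ne h hne)
        exact hb y (.inl ⟨B, hB, hy⟩)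
    subst hBp
    refine ⟨_, ⟨hC.1.diff_singleton hB, fun E hE => hM.ncard_sUnion_le ?_ hE⟩,
      .inr ⟨p, hB, rfl⟩⟩
    congr 1
    rw [hl]
    ext x
    constructor
    · rintro (rfl | hx) ⟨E, ⟨hE, hne⟩, hxE⟩
      · exact hne (hC.1.eq_of_mem hE hB hxE rfl)
      · exact hx ⟨E, hE, hxE⟩
    · intro hx
      by_contra h
      rw [Set.mem_insert_iff, not_or, Set.notMem_compl_iff] at h
      obtain ⟨hxp, E, hE, hxE⟩ := h
      refine hx ⟨E, ⟨hE, ?_⟩, hxE⟩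
      rintro rfl
      exact hxp hxE

end ChainFamily

end GreeneKleitman

theorem theorem8p6 {P : Type*} [PartialOrder P] [Finite P] :
    (∀ (k : ℕ) (C : Set (Set P)),
      GreeneKleitman.IsMaximalChainFamily k C → ⋃₀ C ≠ Set.univ →
        ∃ C' : Set (Set P), GreeneKleitman.IsMaximalChainFamily (k + 1) C' ∧
          (GreeneKleitman.DiffersByPath C C' ∨
            ∃ p : P, p ∉ ⋃₀ C ∧ C' = insert {p} C)) ∧
    (∀ (k : ℕ) (C : Set (Set P)),
      GreeneKleitman.IsMaximalChainFamily k C → 0 < k →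
        ∃ C' : Set (Set P), GreeneKleitman.IsMaximalChainFamily (k - 1) C' ∧
          (GreeneKleitman.DiffersByPath C C' ∨
            ∃ p : P, {p} ∈ C ∧ C' = C \ {{p}})) := by
  refine ⟨fun k C hC hne => hC.exists_succ hne, fun k C hC hk => ?_⟩
  obtain ⟨k, rfl⟩ := Nat.exists_eq_succ_of_ne_zero hk.ne'
  exact hC.exists_pred
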